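/- For integers $d\ge 1$, $r\ge 2$ and $2\le k\le r$, let $T(d,r,k)$ be the smallest positive integer $n$ such that for every list $a_1,\dots,a_n$ of points in $\mathbb{R}^d$ the index set $\{1,\dots,n\}$ can be partitioned into $r$ parts $N_1,\dots,N_r$ such that every $k$ of the $r$ convex hulls $\operatorname{conv}\{a_i : i\in N_j\}$ have a point in common, and let $T(d,r)=(d+1)(r-1)+1$ be the Tverberg number. Then \[T(3,4,2)=T(3,4)=13.\] Moreover, let $p_0,p_1,p_2,p_3\in\mathbb{R}^3$ satisfy $p_0+p_1+p_2+p_3=0$, with each three of them linearly independent. For $0\le i\le 3$ let $p_{i,1},p_{i,2},p_{i,3}$ be three distinct points on the open ray $\{\lambda p_i:\lambda>0\}$, in order of decreasing distance from the origin. Then there is $\delta_0>0$ such that, for all $\delta,\varepsilon\in(0,\delta_0)$, replacing $p_{0,1}$ by $p_{0,1}+\delta p_{3,1}$ and $p_{3,3}$ by $p_{3,3}+\varepsilon p_{0,3}$ turns these $12$ points into $12$ distinct points with the following property: in every partition of them into $4$ parts, some two parts have disjoint convex hulls. -/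

import Mathlib

/-- The convex hull `[a(N_j)]` of the `j`-th part of the list `a`, where the partition of the index
set is given by the labelling `f` (so `N_j` is the set of indices labelled `j`). -/
def partHull {ι : Type*} {d r : ℕ} (a : ι → EuclideanSpace ℝ (Fin d)) (f : ι → Fin r)
    (j : Fin r) : Set (EuclideanSpace ℝ (Fin d)) :=
  convexHull ℝ (a '' {x | f x = j})

/-- Every list of `n` points of `ℝ^d` admits an `r`-partition of its index set such that every `k`
of the `r` convex hulls of the parts have a point in common. (For `1 ≤ k ≤ r` the condition
on the hulls forces all the parts to be nonempty.) -/
def HasReayProperty (d r k n : ℕ) : Prop :=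
  ∀ a : Fin n → EuclideanSpace ℝ (Fin d), ∃ f : Fin n → Fin r,
    ∀ S : Finset (Fin r), S.card = k → (⋂ j ∈ S, partHull a f j).Nonempty

/-- `T(d,r,k)`: the smallest positive integer `n` such that every list of `n` points of `ℝ^d` has an
`r`-partition in which every `k` of the `r` convex hulls have a point in common. The value
would be `0` if there were no such `n`, so an equation `reayNumber d r k = m` with `m` positive
includes the existence of such an `n`. -/
noncomputable def reayNumber (d r k : ℕ) : ℕ :=
  sInf {n : ℕ | 0 < n ∧ HasReayProperty d r k n}

/-- The Tverberg number `T(d,r) = (d+1)(r-1)+1` (for `r ≥ 1`). -/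
def tverbergNumber (d r : ℕ) : ℕ := (d + 1) * (r - 1) + 1

/-- `p_0, ..., p_d` are the vertices of a `d`-simplex centered at the origin: they sum to zero and
each `d` of them are linearly independent. -/
structure IsCenteredSimplex {d : ℕ} (p : Fin (d + 1) → EuclideanSpace ℝ (Fin d)) : Prop where
  sum_eq_zero : ∑ i, p i = 0
  linearIndependent : ∀ i, LinearIndependent ℝ (fun j : {j : Fin (d + 1) // j ≠ i} => p j.1)

/-- The ray configuration: the point number `x.2` on the ray from the origin through `p x.1`.
With positive and strictly decreasing factors `c i`, the points `(i, 0)`, `(i, 1)`, `(i, 2)` are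
the highest, the middle and the lowest of three points on the `i`-th open ray. -/
noncomputable def rayConfig (p : Fin 4 → EuclideanSpace ℝ (Fin 3)) (c : Fin 4 → Fin 3 → ℝ)
    (x : Fin 4 × Fin 3) : EuclideanSpace ℝ (Fin 3) :=
  c x.1 x.2 • p x.1

/-- The ray configuration with two points moved: the highest point on the ray `0` is moved by
`δ` times the highest point on the ray `3`, and the lowest point on the ray `3` is moved by `ε`
times the lowest point on the ray `0`. -/
noncomputable def perturbedRayConfig (p : Fin 4 → EuclideanSpace ℝ (Fin 3))
    (c : Fin 4 → Fin 3 → ℝ) (δ ε : ℝ) (x : Fin 4 × Fin 3) : EuclideanSpace ℝ (Fin 3) :=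
  if x = (0, 0) then rayConfig p c (0, 0) + δ • rayConfig p c (3, 0)
  else if x = (3, 2) then rayConfig p c (3, 2) + ε • rayConfig p c (0, 2)
  else rayConfig p c x

/-! The upper bound is Tverberg's theorem, obtained from the colorful Carathéodory theorem by
Sarkaria's tensor trick.

For the lower bound, hulls of two parts of the unperturbed ray configuration can meet only if the
labels satisfy the order condition `Crosses` (`crosses_of_not_disjoint`). A pair of parts violating
it is strictly separated and stays disjoint under small perturbations; there are finitely many
labellings, so one `δ₀` serves all of these.

The remaining labellings are rigid. No label lies on all four rays, so every ordered pair of labels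
must occur as (higher, lower) on some ray. The rays offer 4 · 3 = 12 such pairs, exactly the number
of ordered pairs of labels, so each occurs once; each ray misses one label, and the missing labels
form a permutation `m` (`exists_missing_label`).

The two moved points defeat these labellings for all positive `δ`, `ε`
(`exists_disjoint_of_crosses`). Let the highest point on ray 0 have label `m j`. If `j ≠ 3`, its
shift along `p 3` separates the parts `m j` and `m 3`. If `j = 3`, the lowest point on ray 3 has a
label `m k` with `k ≠ 0`, and its shift along `p 0` separates `m k` and `m 0`. -/

/-! ### Colorful Carathéodory and Tverberg. -/

theorem mem_convexHull_image_iff {ι E : Type*} [Fintype ι] [AddCommGroup E] [Module ℝ E]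
    (a : ι → E) (P : Set ι) (x : E) :
    x ∈ convexHull ℝ (a '' P) ↔ ∃ w : ι → ℝ, (∀ i, 0 ≤ w i) ∧ (∀ i, i ∉ P → w i = 0) ∧
      ∑ i, w i = 1 ∧ ∑ i, w i • a i = x := by
  classical
  constructor
  · intro hx
    refine convexHull_min (t := {x | ∃ w : ι → ℝ, (∀ i, 0 ≤ w i) ∧ (∀ i, i ∉ P → w i = 0) ∧
      ∑ i, w i = 1 ∧ ∑ i, w i • a i = x}) ?_ ?_ hx
    · rintro _ ⟨i, hi, rfl⟩
      refine ⟨Pi.single i 1, fun j => ?_, fun j hj => ?_, ?_, ?_⟩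
      · by_cases h : j = i
        · subst h; simp
        · simp [h]
      · have : j ≠ i := fun h => hj (h ▸ hi)
        simp [this]
      · simp
      · simp [Pi.single_apply]
    · rintro _ ⟨w, h1, h2, h3, rfl⟩ _ ⟨v, g1, g2, g3, rfl⟩ s t hs ht hst
      refine ⟨fun i => s * w i + t * v i, fun i => ?_, fun i hi => ?_, ?_, ?_⟩
      · have := h1 i
        have := g1 i
        positivity
      · simp [h2 i hi, g2 i hi]
      · rw [Finset.sum_add_distrib, ← Finset.mul_sum, ← Finset.mul_sum, h3, g3]
        simpa using hst
      · simp only [add_smul, mul_smul, Finset.sum_add_distrib, Finset.smul_sum]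
  · rintro ⟨w, h1, h2, h3, rfl⟩
    have e1 : ∑ i with i ∈ P, w i = ∑ i, w i := by
      rw [Finset.sum_filter]
      exact Finset.sum_congr rfl fun i _ => by
        by_cases h : i ∈ P <;> simp [h, h2]
    have e2 : ∑ i with i ∈ P, w i • a i = ∑ i, w i • a i := by
      rw [Finset.sum_filter]
      exact Finset.sum_congr rfl fun i _ => by
        by_cases h : i ∈ P <;> simp [h, h2]
    rw [← e2]
    refine (convex_convexHull ℝ _).sum_mem (fun i _ => h1 i) (e1.trans h3) fun i hi => ?_
    exact subset_convexHull ℝ _ ⟨i, (Finset.mem_filter.1 hi).2, rfl⟩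

theorem exists_norm_add_smul_lt {V : Type*} [NormedAddCommGroup V] [InnerProductSpace ℝ V]
    {x y : V} (h : inner ℝ x y < ‖x‖ ^ 2) :
    ∃ t : ℝ, 0 < t ∧ t ≤ 1 ∧ ‖x + t • (y - x)‖ < ‖x‖ := by
  have hc : 0 < -inner ℝ x (y - x) := by
    rw [inner_sub_right, real_inner_self_eq_norm_sq]
    linarith
  set c := -inner ℝ x (y - x) with hcdef
  have hne : y - x ≠ 0 := by
    intro h0
    rw [hcdef, h0] at hc
    simp at hc
  have hD : 0 < ‖y - x‖ ^ 2 := by positivity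
  refine ⟨min 1 (c / ‖y - x‖ ^ 2), by positivity, min_le_left _ _, ?_⟩
  set t := min 1 (c / ‖y - x‖ ^ 2) with ht
  have ht0 : 0 < t := by positivity
  have htD : t * ‖y - x‖ ^ 2 ≤ c := by
    rw [← le_div_iff₀ hD]
    exact min_le_right _ _
  have key : ‖x + t • (y - x)‖ ^ 2 < ‖x‖ ^ 2 := by
    rw [norm_add_sq_real, inner_smul_right, norm_smul, mul_pow, Real.norm_eq_abs, sq_abs]
    have : inner ℝ x (y - x) = -c := by rw [hcdef]; ring
    rw [this]
    nlinarith [mul_le_mul_of_nonneg_left htD ht0.le, mul_pos ht0 hc]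
  exact lt_of_pow_lt_pow_left₀ 2 (norm_nonneg _) key

/-- A colorful Carathéodory theorem. -/
theorem exists_zero_mem_convexHull_transversal {V : Type*} [NormedAddCommGroup V]
    [InnerProductSpace ℝ V] [FiniteDimensional ℝ V] {ι κ : Type*} [Fintype ι] [Finite κ]
    [Nonempty κ] (hcard : Module.finrank ℝ V < Fintype.card ι) (z : ι → κ → V)
    (hz : ∀ i, (0 : V) ∈ convexHull ℝ (Set.range (z i))) :
    ∃ f : ι → κ, (0 : V) ∈ convexHull ℝ (Set.range fun i => z i (f i)) := by
  classical
  have hι : Nonempty ι := Fintype.card_pos_iff.1 (by omega)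
  obtain ⟨f, hf⟩ := Finite.exists_min
    fun f : ι → κ => Metric.infDist 0 (convexHull ℝ (Set.range fun i => z i (f i)))
  refine ⟨f, ?_⟩
  have hK : IsCompact (convexHull ℝ (Set.range fun i => z i (f i))) :=
    (Set.finite_range _).isCompact_convexHull ℝ
  have hKne : (convexHull ℝ (Set.range fun i => z i (f i))).Nonempty :=
    (Set.range_nonempty _).convexHull
  obtain ⟨x, hxK, hx⟩ := hK.exists_infDist_eq_dist hKne 0
  by_contra h0
  have hx0 : x ≠ 0 := fun h => h0 (h ▸ hxK)
  have hmin : ∀ g : ι → κ, ∀ y ∈ convexHull ℝ (Set.range fun i => z i (g i)), ‖x‖ ≤ ‖y‖ := by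
    intro g y hy
    have h1 := hf g
    have h2 := Metric.infDist_le_dist_of_mem (x := (0 : V)) hy
    simp only [hx] at h1
    rw [dist_zero_left] at h1 h2
    exact h1.trans h2
  have hsupp : ∀ g : ι → κ, x ∈ convexHull ℝ (Set.range fun i => z i (g i)) →
      ∀ y ∈ convexHull ℝ (Set.range fun i => z i (g i)), ‖x‖ ^ 2 ≤ inner ℝ x y := by
    intro g hg y hy
    by_contra! hlt
    obtain ⟨t, ht0, ht1, ht⟩ := exists_norm_add_smul_lt hlt
    exact ht.not_ge
      (hmin g _ ((convex_convexHull ℝ _).add_smul_sub_mem hg hy ⟨ht0.le, ht1⟩))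
  -- The affinely independent points carrying `x` all lie on the supporting hyperplane at `x`, so
  -- there are at most `finrank ℝ V` of them. Hence some color `i₀` is not needed and its point can
  -- be exchanged freely for one with nonpositive inner product with `x`.
  obtain ⟨ι', _, u, w, hu, hind, hw0, hw1, hwx⟩ := eq_pos_convex_span_of_mem_convexHull hxK
  have hge : ∀ k, ‖x‖ ^ 2 ≤ inner ℝ x (u k) := fun k =>
    hsupp f hxK _ (subset_convexHull ℝ _ (hu ⟨k, rfl⟩))
  have hsum : ∑ k, w k * (inner ℝ x (u k) - ‖x‖ ^ 2) = 0 := by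
    simp only [mul_sub, Finset.sum_sub_distrib, ← Finset.sum_mul, hw1]
    rw [one_mul, sub_eq_zero, ← real_inner_self_eq_norm_sq]
    conv_rhs => rw [← hwx]
    rw [hwx, ← hwx, inner_sum]
    simp only [inner_smul_right, hwx]
  have heq : ∀ k, inner ℝ x (u k) = ‖x‖ ^ 2 := by
    intro k
    have := (Finset.sum_eq_zero_iff_of_nonneg fun k _ =>
      mul_nonneg (hw0 k).le (sub_nonneg.2 (hge k))).1 hsum k (Finset.mem_univ _)
    rcases mul_eq_zero.1 this with h | h
    · exact absurd h (hw0 k).ne'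
    · linarith
  have hspan : vectorSpan ℝ (Set.range u) ≤ (ℝ ∙ x)ᗮ := by
    rw [vectorSpan_def, Submodule.span_le]
    rintro _ ⟨_, ⟨k, rfl⟩, _, ⟨l, rfl⟩, rfl⟩
    rw [SetLike.mem_coe, Submodule.mem_orthogonal_singleton_iff_inner_right]
    simp [inner_sub_right, heq]
  have hcard' : Fintype.card ι' < Fintype.card ι := by
    have h1 := hind.card_le_finrank_succ
    have h2 := Submodule.finrank_mono hspan
    have h3 := Submodule.finrank_add_finrank_orthogonal (ℝ ∙ x)
    rw [finrank_span_singleton hx0] at h3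
    omega
  choose g hg using fun k => hu ⟨k, rfl⟩
  obtain ⟨i₀, hi₀⟩ : ∃ i, ∀ k, g k ≠ i := by
    by_contra! hsurj
    exact hcard'.not_ge (Fintype.card_le_of_surjective g hsurj)
  obtain ⟨c, hc⟩ : ∃ c, inner ℝ x (z i₀ c) ≤ 0 := by
    by_contra! hpos
    have hsub : convexHull ℝ (Set.range (z i₀)) ⊆ {y | 0 < inner ℝ x y} := by
      refine convexHull_min ?_ (convex_halfSpace_gt ?_ 0)
      · rintro _ ⟨c, rfl⟩
        exact hpos c
      · exact (innerSL ℝ x).toLinearMap.isLinear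
    have := hsub (hz i₀)
    simp at this
  have hxf' : x ∈ convexHull ℝ (Set.range fun i => z i (Function.update f i₀ c i)) := by
    rw [← hwx]
    refine (convex_convexHull ℝ _).sum_mem (fun k _ => (hw0 k).le) hw1 fun k _ => ?_
    refine subset_convexHull ℝ _ ⟨g k, ?_⟩
    simp only [Function.update_of_ne (hi₀ k)]
    exact hg k
  have hlast := hsupp _ hxf' (z i₀ c) (subset_convexHull ℝ _ ⟨i₀, by simp⟩)
  have : 0 < ‖x‖ ^ 2 := by positivity
  linarith

/-- Tverberg's theorem. -/
theorem exists_tverberg_partition {d s : ℕ} {ι : Type*} [Fintype ι]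
    (hcard : (d + 1) * s < Fintype.card ι) (a : ι → EuclideanSpace ℝ (Fin d)) :
    ∃ f : ι → Fin (s + 1), (⋂ j, partHull a f j).Nonempty := by
  classical
  -- Sarkaria's trick: tensor the lifts `(1, a i)` with vectors `v c` whose only linear relations
  -- have equal coefficients. A transversal with zero in its hull then says that the weighted sum of
  -- the lifts is the same over every label class.
  let b : ι → Option (Fin d) → ℝ := fun i o => o.elim 1 fun k => a i k
  let v : Fin (s + 1) → Fin s → ℝ := fun c j =>
    (if c = j.succ then 1 else 0) - (if c = 0 then 1 else 0)
  let z : ι → Fin (s + 1) → EuclideanSpace ℝ (Option (Fin d) × Fin s) := fun i c =>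
    WithLp.toLp 2 fun q => b i q.1 * v c q.2
  have hv : ∀ j, ∑ c, v c j = 0 := by
    intro j
    simp [v]
  obtain ⟨f, hf⟩ := exists_zero_mem_convexHull_transversal (ι := ι) (by simpa using hcard) z (by
    intro i
    rw [← Set.image_univ, mem_convexHull_image_iff]
    refine ⟨fun _ => 1 / (s + 1), fun _ => by positivity, by simp, ?_, ?_⟩
    · simp
      field_simp
    · ext q
      simp only [z, WithLp.ofLp_sum, WithLp.ofLp_smul, Finset.sum_apply, Pi.smul_apply,
        smul_eq_mul, ← Finset.mul_sum, hv]
      simp)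
  rw [← Set.image_univ, mem_convexHull_image_iff] at hf
  obtain ⟨w, hw0, -, hw1, hwz⟩ := hf
  have hcoord : ∀ o c, ∑ i with f i = c, w i * b i o = ∑ i with f i = 0, w i * b i o := by
    intro o c
    refine Fin.cases rfl (fun j => ?_) c
    have := congrArg (fun y : EuclideanSpace ℝ (Option (Fin d) × Fin s) => y (o, j)) hwz
    simp only [z, v, WithLp.ofLp_sum, WithLp.ofLp_smul, Finset.sum_apply, Pi.smul_apply,
      smul_eq_mul, mul_sub, Finset.sum_sub_distrib, mul_ite, mul_one, mul_zero] at this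
    rw [← Finset.sum_filter, ← Finset.sum_filter] at this
    exact sub_eq_zero.1 this
  have hσ : ∀ c, ∑ i with f i = c, w i = 1 / (s + 1) := by
    have h1 : ∀ c, ∑ i with f i = c, w i = ∑ i with f i = 0, w i := fun c => by
      simpa [b] using hcoord none c
    have h2 : ∑ c, ∑ i with f i = c, w i = 1 := by
      rw [← hw1]
      exact Finset.sum_fiberwise _ _ _
    intro c
    simp only [h1, Finset.sum_const, Finset.card_univ, Fintype.card_fin, nsmul_eq_mul] at h2
    rw [h1, eq_div_iff (by positivity), mul_comm]
    exact_mod_cast h2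
  refine ⟨f, ∑ i with f i = 0, ((s + 1) * w i) • a i, Set.mem_iInter.2 fun c => ?_⟩
  have hx : ∑ i with f i = 0, ((s + 1) * w i) • a i = ∑ i with f i = c, ((s + 1) * w i) • a i := by
    ext k
    have := hcoord (some k) c
    simp only [b, Option.elim] at this
    simp only [WithLp.ofLp_sum, WithLp.ofLp_smul, Finset.sum_apply, Pi.smul_apply, smul_eq_mul,
      mul_assoc, ← Finset.mul_sum, this]
  rw [hx]
  refine (convex_convexHull ℝ _).sum_mem (fun i _ => ?_) ?_ fun i hi => ?_
  · have := hw0 i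
    positivity
  · rw [← Finset.mul_sum, hσ]
    field_simp
  · exact subset_convexHull ℝ _ ⟨i, (Finset.mem_filter.1 hi).2, rfl⟩

/-! ### Combinatorics of the labellings. -/

/-- On the ray `r`, some point labelled `x` lies above some point labelled `y`. -/
def IsAbove (f : Fin 4 × Fin 3 → Fin 4) (r x y : Fin 4) : Prop :=
  ∃ s t : Fin 3, s < t ∧ f (r, s) = x ∧ f (r, t) = y

/-- The label `x` occurs on every ray. -/
def IsFull (f : Fin 4 × Fin 3 → Fin 4) (x : Fin 4) : Prop :=
  ∀ r, ∃ s, f (r, s) = x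

/-- The order-theoretic condition for the hulls of the parts `x` and `y` of a ray configuration
to meet. -/
def Crosses (f : Fin 4 × Fin 3 → Fin 4) (x y : Fin 4) : Prop :=
  ((∃ r, IsAbove f r x y) ∧ ∃ r, IsAbove f r y x) ∨
    (IsFull f x ∧ ∃ r, IsAbove f r x y) ∨ (IsFull f y ∧ ∃ r, IsAbove f r y x)

theorem Crosses.exists_ray {f : Fin 4 × Fin 3 → Fin 4} {x y : Fin 4} (h : Crosses f x y) :
    ∃ r s t, f (r, s) = x ∧ f (r, t) = y := by
  rcases h with ⟨⟨r, s, t, -, h1, h2⟩, -⟩ | ⟨-, r, s, t, -, h1, h2⟩ | ⟨-, r, s, t, -, h1, h2⟩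
  · exact ⟨r, s, t, h1, h2⟩
  · exact ⟨r, s, t, h1, h2⟩
  · exact ⟨r, t, s, h2, h1⟩

theorem Crosses.exists_isAbove {f : Fin 4 × Fin 3 → Fin 4} {x y : Fin 4} (h : Crosses f x y)
    (hx : ¬ IsFull f x) (hy : ¬ IsFull f y) : ∃ r, IsAbove f r x y := by
  rcases h with h | h | h
  · exact h.1
  · exact absurd h.1 hx
  · exact absurd h.1 hy

theorem not_four_labels {f : Fin 4 × Fin 3 → Fin 4} {r a b x y : Fin 4} (hab : a ≠ b) (hax : a ≠ x)
    (hay : a ≠ y) (hbx : b ≠ x) (hby : b ≠ y) (hxy : x ≠ y) (ha : ∃ s, f (r, s) = a)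
    (hb : ∃ s, f (r, s) = b) (hx : ∃ s, f (r, s) = x) (hy : ∃ s, f (r, s) = y) : False := by
  obtain ⟨s, rfl⟩ := ha
  obtain ⟨t, rfl⟩ := hb
  obtain ⟨u, rfl⟩ := hx
  obtain ⟨v, rfl⟩ := hy
  have h1 : s ≠ t := fun h => hab (by rw [h])
  have h2 : s ≠ u := fun h => hax (by rw [h])
  have h3 : s ≠ v := fun h => hay (by rw [h])
  have h4 : t ≠ u := fun h => hbx (by rw [h])
  have h5 : t ≠ v := fun h => hby (by rw [h])
  have h6 : u ≠ v := fun h => hxy (by rw [h])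
  omega

theorem IsAbove.exists_left {f : Fin 4 × Fin 3 → Fin 4} {r x y : Fin 4} (h : IsAbove f r x y) :
    ∃ s, f (r, s) = x :=
  let ⟨s, _, _, h, _⟩ := h
  ⟨s, h⟩

theorem IsAbove.exists_right {f : Fin 4 × Fin 3 → Fin 4} {r x y : Fin 4} (h : IsAbove f r x y) :
    ∃ s, f (r, s) = y :=
  let ⟨_, t, _, _, h⟩ := h
  ⟨t, h⟩

theorem IsAbove.not_symm_of_mem {f : Fin 4 × Fin 3 → Fin 4} {r a x y : Fin 4} (hxy : x ≠ y)
    (hax : a ≠ x) (hay : a ≠ y) (ha : ∃ s, f (r, s) = a) (h : IsAbove f r x y)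
    (h' : IsAbove f r y x) : False := by
  obtain ⟨q, rfl⟩ := ha
  obtain ⟨s, t, hst, rfl, rfl⟩ := h
  obtain ⟨u, v, huv, h1, h2⟩ := h'
  have e1 : q ≠ s := fun h => hax (by rw [h])
  have e2 : q ≠ t := fun h => hay (by rw [h])
  have e3 : q ≠ u := fun h => hay (by rw [h, h1])
  have e4 : q ≠ v := fun h => hax (by rw [h, h2])
  have e5 : s ≠ u := fun h => hxy (by rw [h, h1])
  have e6 : t ≠ v := fun h => hxy (by rw [← h2, h])
  omega

theorem exists_two_others : ∀ a b : Fin 4, a ≠ b → ∃ x y : Fin 4, x ≠ y ∧ a ≠ x ∧ a ≠ y ∧ b ≠ x ∧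
    b ≠ y := by
  decide

theorem exists_three_others : ∀ a : Fin 4, ∃ x y z : Fin 4, x ≠ y ∧ x ≠ z ∧ y ≠ z ∧ a ≠ x ∧ a ≠ y ∧
    a ≠ z := by
  decide

theorem not_five_distinct {a b c d e : Fin 4} (hab : a ≠ b) (hac : a ≠ c) (had : a ≠ d)
    (hae : a ≠ e) (hbc : b ≠ c) (hbd : b ≠ d) (hbe : b ≠ e) (hcd : c ≠ d) (hce : c ≠ e)
    (hde : d ≠ e) : False := by
  have h : [a, b, c, d, e].Nodup := by simp [*]
  have := h.length_le_card
  simp at this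

/-- A second full label would leave no ray for the other two labels to share. With `a` alone full,
every ray has room for only two points with other labels, so five of the order relations among the
other three labels would need five distinct rays. -/
theorem not_isFull_of_crosses {f : Fin 4 × Fin 3 → Fin 4} (H : ∀ x y, x ≠ y → Crosses f x y)
    (a : Fin 4) : ¬ IsFull f a := by
  intro ha
  have hunique : ∀ b, b ≠ a → ¬ IsFull f b := by
    intro b hba hb
    obtain ⟨x, y, hxy, h1, h2, h3, h4⟩ := exists_two_others a b hba.symm
    obtain ⟨r, s, t, hs, ht⟩ := (H x y hxy).exists_ray
    exact not_four_labels hba.symm h1 h2 h3 h4 hxy (ha r) (hb r) ⟨s, hs⟩ ⟨t, ht⟩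
  obtain ⟨x, y, z, hxy, hxz, hyz, hx, hy, hz⟩ := exists_three_others a
  have key : ∀ u v, u ≠ v → a ≠ u → a ≠ v → ∃ r, IsAbove f r u v := fun u v huv hu hv =>
    (H u v huv).exists_isAbove (hunique u hu.symm) (hunique v hv.symm)
  obtain ⟨r₁, h₁⟩ := key x y hxy hx hy
  obtain ⟨r₂, h₂⟩ := key y x hxy.symm hy hx
  obtain ⟨r₃, h₃⟩ := key x z hxz hx hz
  obtain ⟨r₄, h₄⟩ := key z x hxz.symm hz hx
  obtain ⟨r₅, h₅⟩ := key y z hyz hy hz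
  have four : ∀ r, (∃ s, f (r, s) = x) → (∃ s, f (r, s) = y) → (∃ s, f (r, s) = z) → False :=
    fun r => not_four_labels hx hy hz hxy hxz hyz (ha r)
  have h12 : r₁ ≠ r₂ := fun h => h₁.not_symm_of_mem hxy hx hy (ha _) (h ▸ h₂)
  have h34 : r₃ ≠ r₄ := fun h => h₃.not_symm_of_mem hxz hx hz (ha _) (h ▸ h₄)
  have h13 : r₁ ≠ r₃ := fun h => four r₁ h₁.exists_left h₁.exists_right (h ▸ h₃.exists_right)
  have h14 : r₁ ≠ r₄ := fun h => four r₁ h₁.exists_left h₁.exists_right (h ▸ h₄.exists_left)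
  have h15 : r₁ ≠ r₅ := fun h => four r₁ h₁.exists_left h₁.exists_right (h ▸ h₅.exists_right)
  have h23 : r₂ ≠ r₃ := fun h => four r₂ h₂.exists_right h₂.exists_left (h ▸ h₃.exists_right)
  have h24 : r₂ ≠ r₄ := fun h => four r₂ h₂.exists_right h₂.exists_left (h ▸ h₄.exists_left)
  have h25 : r₂ ≠ r₅ := fun h => four r₂ h₂.exists_right h₂.exists_left (h ▸ h₅.exists_right)
  have h35 : r₃ ≠ r₅ := fun h => four r₃ h₃.exists_left (h ▸ h₅.exists_left) h₃.exists_right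
  have h45 : r₄ ≠ r₅ := fun h => four r₄ h₄.exists_right (h ▸ h₅.exists_left) h₄.exists_left
  exact not_five_distinct h12 h13 h14 h15 h23 h24 h25 h34 h35 h45

/-- A surjection from the 12 pairs of positions on a common ray onto the 12 ordered pairs of
distinct labels is a bijection. -/
theorem injective_and_unique_ray {f : Fin 4 × Fin 3 → Fin 4}
    (H : ∀ x y, x ≠ y → ∃ r, IsAbove f r x y) :
    (∀ r s t, f (r, s) = f (r, t) → s = t) ∧
      ∀ r r' x y, IsAbove f r x y → IsAbove f r' x y → r = r' := by
  let g : Fin 4 × {q : Fin 3 × Fin 3 // q.1 < q.2} → Fin 4 × Fin 4 := fun p =>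
    (f (p.1, p.2.1.1), f (p.1, p.2.1.2))
  have hsub : (Finset.univ : Finset (Fin 4)).offDiag ⊆ Finset.univ.image g := by
    rintro ⟨x, y⟩ hxy
    obtain ⟨r, s, t, hst, rfl, rfl⟩ := H x y (Finset.mem_offDiag.1 hxy).2.2
    exact Finset.mem_image.2 ⟨(r, ⟨(s, t), hst⟩), Finset.mem_univ _, rfl⟩
  have hdom : (Finset.univ : Finset (Fin 4 × {q : Fin 3 × Fin 3 // q.1 < q.2})).card = 12 := by
    rw [Finset.card_univ, Fintype.card_prod, Fintype.card_fin, Fintype.card_subtype]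
    rfl
  have hoff : (Finset.univ : Finset (Fin 4)).offDiag.card = 12 := by
    rw [Finset.offDiag_card, Finset.card_univ, Fintype.card_fin]
  have himg := Finset.eq_of_subset_of_card_le hsub (by
    rw [hoff, ← hdom]
    exact Finset.card_image_le)
  have hinj : Function.Injective g := by
    have himg_card : (Finset.univ.image g).card = 12 := by rw [← himg, hoff]
    have h := Finset.card_image_iff.1 (himg_card.trans hdom.symm)
    rwa [Finset.coe_univ, Set.injOn_univ] at h
  have hne : ∀ r s t, s < t → f (r, s) ≠ f (r, t) := by
    intro r s t hst
    have : g (r, ⟨(s, t), hst⟩) ∈ (Finset.univ : Finset (Fin 4)).offDiag := by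
      rw [himg]
      exact Finset.mem_image_of_mem _ (Finset.mem_univ _)
    exact (Finset.mem_offDiag.1 this).2.2
  refine ⟨fun r s t h => ?_, ?_⟩
  · rcases lt_trichotomy s t with hst | hst | hst
    · exact absurd h (hne r s t hst)
    · exact hst
    · exact absurd h.symm (hne r t s hst)
  · rintro r r' _ _ ⟨s, t, hst, rfl, rfl⟩ ⟨s', t', hst', h1, h2⟩
    have : g (r, ⟨(s, t), hst⟩) = g (r', ⟨(s', t'), hst'⟩) := Prod.ext h1.symm h2.symm
    exact congrArg Prod.fst (hinj this)

/-- If all the parts cross pairwise, then the labels missing on the four rays are distinct, every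
other label occurs exactly once on a ray, and it cannot happen that the label missing on the ray `j`
is highest on the ray `i` while the label missing on `i` is lowest on `j`. -/
theorem exists_missing_label {f : Fin 4 × Fin 3 → Fin 4} (H : ∀ x y, x ≠ y → Crosses f x y) :
    (∀ r s t, f (r, s) = f (r, t) → s = t) ∧ ∃ m : Fin 4 → Fin 4, Function.Bijective m ∧
      (∀ r s, f (r, s) ≠ m r) ∧ (∀ r x, x ≠ m r → ∃ s, f (r, s) = x) ∧
      ∀ i j, i ≠ j → f (i, 0) = m j → f (j, 2) = m i → False := by
  have hfull := not_isFull_of_crosses H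
  have H' : ∀ x y, x ≠ y → ∃ r, IsAbove f r x y := fun x y h =>
    (H x y h).exists_isAbove (hfull x) (hfull y)
  obtain ⟨hinj, huniq⟩ := injective_and_unique_ray H'
  refine ⟨hinj, ?_⟩
  have hmiss : ∀ r, ∃ x, ∀ s, f (r, s) ≠ x := by
    intro r
    by_contra! hsurj
    have := Fintype.card_le_of_surjective (fun s => f (r, s)) hsurj
    simp at this
  choose m hm using hmiss
  have hocc : ∀ r x, x ≠ m r → ∃ s, f (r, s) = x := by
    intro r x hx
    have hcard : (Finset.univ.image fun s => f (r, s)).card = 3 := by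
      rw [Finset.card_image_of_injective _ (hinj r), Finset.card_univ, Fintype.card_fin]
    have hsub : (Finset.univ.image fun s => f (r, s)) ⊆ Finset.univ.erase (m r) := by
      intro y hy
      obtain ⟨s, -, rfl⟩ := Finset.mem_image.1 hy
      exact Finset.mem_erase.2 ⟨hm r s, Finset.mem_univ _⟩
    have heq := Finset.eq_of_subset_of_card_le hsub (by
      rw [hcard, Finset.card_erase_of_mem (Finset.mem_univ _)]
      simp)
    have : x ∈ Finset.univ.image fun s => f (r, s) := by
      rw [heq]
      exact Finset.mem_erase.2 ⟨hx, Finset.mem_univ _⟩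
    obtain ⟨s, -, hs⟩ := Finset.mem_image.1 this
    exact ⟨s, hs⟩
  have hasymm : ∀ r x y, IsAbove f r x y → IsAbove f r y x → False := by
    rintro r _ _ ⟨s, t, hst, rfl, rfl⟩ ⟨u, v, huv, h1, h2⟩
    have h1 := hinj r _ _ h1
    have h2 := hinj r _ _ h2
    omega
  have htotal : ∀ r x y, x ≠ y → (∃ s, f (r, s) = x) → (∃ s, f (r, s) = y) →
      IsAbove f r x y ∨ IsAbove f r y x := by
    rintro r _ _ hxy ⟨s, rfl⟩ ⟨t, rfl⟩
    rcases lt_trichotomy s t with h | h | h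
    · exact Or.inl ⟨s, t, h, rfl, rfl⟩
    · exact absurd (by rw [h]) hxy
    · exact Or.inr ⟨t, s, h, rfl, rfl⟩
  have hminj : Function.Injective m := by
    intro r r' hrr
    by_contra hne
    obtain ⟨x, hx⟩ : ∃ x, x = m r := ⟨_, rfl⟩
    have hr : ∀ s, f (r, s) ≠ x := hx ▸ hm r
    have hr' : ∀ s, f (r', s) ≠ x := hx ▸ hrr ▸ hm r'
    obtain ⟨y, z, w, hyz, hyw, hzw, hxy, hxz, hxw⟩ := exists_three_others x
    obtain ⟨q, hq⟩ := H' x y hxy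
    have hqr : ∀ u v, IsAbove f u x v → u ≠ r ∧ u ≠ r' := by
      rintro u v ⟨s, t, -, h1, -⟩
      exact ⟨fun h => hr s (h ▸ h1), fun h => hr' s (h ▸ h1)⟩
    have hqr' : ∀ u v, IsAbove f u v x → u ≠ r ∧ u ≠ r' := by
      rintro u v ⟨s, t, -, -, h1⟩
      exact ⟨fun h => hr t (h ▸ h1), fun h => hr' t (h ▸ h1)⟩
    have hmem : ∀ v, x ≠ v → ∃ s, f (q, s) = v := by
      intro v hv
      obtain ⟨a, ha⟩ := H' x v hv
      obtain ⟨b, hb⟩ := H' v x hv.symm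
      have hab : a ≠ b := fun h => hasymm a x v ha (h ▸ hb)
      have h1 := hqr _ _ hq
      have h2 := hqr _ _ ha
      have h3 := hqr' _ _ hb
      -- At most two rays carry `x`, and both orders of `x` and `v` need a ray of their own. So `v`
      -- occurs on every ray that carries `x`, which puts four labels on `q`.
      have : q = a ∨ q = b := by
        by_contra! h
        exact not_five_distinct hne h1.1.symm h2.1.symm h3.1.symm h1.2.symm h2.2.symm h3.2.symm
          h.1 h.2 hab
      rcases this with rfl | rfl
      · exact ha.exists_right
      · exact hb.exists_left
    exact not_four_labels hxy hxz hxw hyz hyw hzw hq.exists_left (hmem y hxy) (hmem z hxz)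
      (hmem w hxw)
  refine ⟨m, Finite.injective_iff_bijective.1 hminj, hm, hocc, ?_⟩
  intro i j hij hhigh hlow
  -- The pairs already used on the rays `i` and `j` force the order `m i`, `m l`, `m j` downwards on
  -- the ray `k`, and likewise with `k` and `l` exchanged. Then `m i` is above `m j` on two rays.
  obtain ⟨k, l, hkl, hik, hil, hjk, hjl⟩ := exists_two_others i j hij
  have hon : ∀ r q, q ≠ r → ∃ s, f (r, s) = m q := fun r q h => hocc r _ (hminj.ne h)
  have htop : ∀ q, q ≠ i → q ≠ j → IsAbove f i (m j) (m q) := by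
    intro q hqi hqj
    obtain ⟨s, hs⟩ := hon i q hqi
    refine ⟨0, s, ?_, hhigh, hs⟩
    have : s ≠ 0 := fun h => hqj (hminj (by rw [← hs, h, hhigh]))
    omega
  have hbot : ∀ q, q ≠ i → q ≠ j → IsAbove f j (m q) (m i) := by
    intro q hqi hqj
    obtain ⟨s, hs⟩ := hon j q hqj
    refine ⟨s, 2, ?_, hs, hlow⟩
    have : s ≠ 2 := fun h => hqi (hminj (by rw [← hs, h, hlow]))
    omega
  have hmid : ∀ q r, q ≠ r → q ≠ i → q ≠ j → r ≠ i → r ≠ j → IsAbove f r (m i) (m j) := by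
    intro q r hqr hqi hqj hri hrj
    have h1 : IsAbove f r (m q) (m j) :=
      (htotal r _ _ (hminj.ne hqj) (hon r q hqr) (hon r j hrj.symm)).resolve_right
        fun h => hri (huniq _ _ _ _ h (htop q hqi hqj))
    have h2 : IsAbove f r (m i) (m q) :=
      (htotal r _ _ (hminj.ne hqi.symm) (hon r i hri.symm) (hon r q hqr)).resolve_right
        fun h => hrj (huniq _ _ _ _ h (hbot q hqi hqj))
    obtain ⟨s, t, hst, hs, ht⟩ := h2
    obtain ⟨u, v, huv, hu, hv⟩ := h1
    have := hinj r _ _ (ht.trans hu.symm)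
    exact ⟨s, v, by omega, hs, hv⟩
  exact hkl (huniq _ _ _ _ (hmid l k hkl.symm hil.symm hjl.symm hik.symm hjk.symm)
    (hmid k l hkl hik.symm hjk.symm hil.symm hjl.symm))

/-! ### Coordinates, meeting hulls and separation. -/

/-- The coordinates of the perturbed ray configuration with respect to `p`. -/
noncomputable def perturbedRayCoord (c : Fin 4 → Fin 3 → ℝ) (δ ε : ℝ) (x : Fin 4 × Fin 3) :
    Fin 4 → ℝ :=
  Pi.single x.1 (c x.1 x.2) + (if x = (0, 0) then Pi.single 3 (δ * c 3 0) else 0) +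
    (if x = (3, 2) then Pi.single 0 (ε * c 0 2) else 0)

theorem perturbedRayConfig_eq_sum (p : Fin 4 → EuclideanSpace ℝ (Fin 3)) (c : Fin 4 → Fin 3 → ℝ)
    (δ ε : ℝ) (x : Fin 4 × Fin 3) :
    perturbedRayConfig p c δ ε x = ∑ k, perturbedRayCoord c δ ε x k • p k := by
  have h (i : Fin 4) (r : ℝ) : ∑ k, (Pi.single i r : Fin 4 → ℝ) k • p k = r • p i := by
    rw [Finset.sum_eq_single i (fun k _ hk => by simp [hk]) (by simp)]
    simp
  unfold perturbedRayConfig perturbedRayCoord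
  by_cases h1 : x = (0, 0)
  · subst h1
    simp [add_smul, Finset.sum_add_distrib, h, rayConfig, smul_smul]
  · by_cases h2 : x = (3, 2)
    · subst h2
      simp [add_smul, Finset.sum_add_distrib, h, rayConfig, smul_smul]
    · simp [h1, h2, h, rayConfig]

theorem IsCenteredSimplex.eq_of_sum_smul_eq_zero {d : ℕ}
    {p : Fin (d + 1) → EuclideanSpace ℝ (Fin d)} (hp : IsCenteredSimplex p) {α : Fin (d + 1) → ℝ}
    (h : ∑ k, α k • p k = 0) (i j : Fin (d + 1)) : α i = α j := by
  by_cases hij : j = i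
  · rw [hij]
  have h' : ∑ k, (α k - α i) • p k = 0 := by
    simp only [sub_smul, Finset.sum_sub_distrib, h, ← Finset.smul_sum, hp.sum_eq_zero, smul_zero,
      sub_zero]
  rw [Fintype.sum_eq_add_sum_subtype_ne _ i, sub_self, zero_smul, zero_add] at h'
  have := Fintype.linearIndependent_iff.1 (hp.linearIndependent i) (fun k => α k.1 - α i) h' ⟨j, hij⟩
  exact (sub_eq_zero.1 this).symm

/-- `w` is a system of convex weights supported on the part of `f` labelled `i`. -/
structure IsPartWeight {ι : Type*} [Fintype ι] {r : ℕ} (f : ι → Fin r) (i : Fin r) (w : ι → ℝ) :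
    Prop where
  nonneg : ∀ x, 0 ≤ w x
  eq_zero : ∀ x, f x ≠ i → w x = 0
  sum_eq_one : ∑ x, w x = 1

theorem IsPartWeight.sum_mul_lt {ι : Type*} [Fintype ι] {r : ℕ} {f : ι → Fin r} {i : Fin r}
    {w : ι → ℝ} (hw : IsPartWeight f i w) {g : ι → ℝ} {b : ℝ} (hg : ∀ x, f x = i → g x < b) :
    ∑ x, w x * g x < b := by
  have hb : b = ∑ x, w x * b := by rw [← Finset.sum_mul, hw.sum_eq_one, one_mul]
  conv_rhs => rw [hb]
  obtain ⟨y, -, hy⟩ : ∃ y ∈ Finset.univ, w y ≠ 0 :=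
    Finset.exists_ne_zero_of_sum_ne_zero (by rw [hw.sum_eq_one]; exact one_ne_zero)
  refine Finset.sum_lt_sum (fun x _ => ?_) ⟨y, Finset.mem_univ _, ?_⟩
  · by_cases hx : f x = i
    · exact mul_le_mul_of_nonneg_left (hg x hx).le (hw.nonneg x)
    · simp [hw.eq_zero x hx]
  · have hfy : f y = i := by
      by_contra h
      exact hy (hw.eq_zero y h)
    exact mul_lt_mul_of_pos_left (hg y hfy) (lt_of_le_of_ne (hw.nonneg y) hy.symm)

theorem IsPartWeight.lt_sum_mul {ι : Type*} [Fintype ι] {r : ℕ} {f : ι → Fin r} {i : Fin r}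
    {w : ι → ℝ} (hw : IsPartWeight f i w) {g : ι → ℝ} {b : ℝ} (hg : ∀ x, f x = i → b < g x) :
    b < ∑ x, w x * g x := by
  have := hw.sum_mul_lt (g := fun x => -g x) (b := -b) fun x hx => neg_lt_neg (hg x hx)
  simp only [mul_neg, Finset.sum_neg_distrib] at this
  linarith

theorem mem_partHull_iff {ι : Type*} [Fintype ι] {d r : ℕ} {a : ι → EuclideanSpace ℝ (Fin d)}
    {f : ι → Fin r} {i : Fin r} {z : EuclideanSpace ℝ (Fin d)} :
    z ∈ partHull a f i ↔ ∃ w, IsPartWeight f i w ∧ ∑ x, w x • a x = z := by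
  unfold partHull
  rw [mem_convexHull_image_iff]
  constructor
  · rintro ⟨w, h1, h2, h3, h4⟩
    exact ⟨w, ⟨h1, h2, h3⟩, h4⟩
  · rintro ⟨w, ⟨h1, h2, h3⟩, h4⟩
    exact ⟨w, h1, h2, h3, h4⟩

/-- Coordinates with respect to `p` are determined only up to a common additive constant, which is
`t` here. -/
theorem IsCenteredSimplex.exists_weights {d r : ℕ} {p : Fin (d + 1) → EuclideanSpace ℝ (Fin d)}
    (hp : IsCenteredSimplex p) {ι : Type*} [Fintype ι] {u : ι → Fin (d + 1) → ℝ}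
    {a : ι → EuclideanSpace ℝ (Fin d)} (ha : ∀ x, a x = ∑ k, u x k • p k) {f : ι → Fin r}
    {i j : Fin r} (h : ¬ Disjoint (partHull a f i) (partHull a f j)) :
    ∃ w v t, IsPartWeight f i w ∧ IsPartWeight f j v ∧
      ∀ k, ∑ x, w x * u x k = ∑ x, v x * u x k + t := by
  obtain ⟨z, hz, hz'⟩ := Set.not_disjoint_iff.1 h
  obtain ⟨w, hw, hwz⟩ := mem_partHull_iff.1 hz
  obtain ⟨v, hv, hvz⟩ := mem_partHull_iff.1 hz'
  have hcomb : ∀ w : ι → ℝ, ∑ x, w x • a x = ∑ k, (∑ x, w x * u x k) • p k := by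
    intro w
    simp only [ha, Finset.smul_sum, Finset.sum_smul, smul_smul]
    exact Finset.sum_comm
  have h0 : ∑ k, (∑ x, w x * u x k - ∑ x, v x * u x k) • p k = 0 := by
    simp only [sub_smul, Finset.sum_sub_distrib]
    rw [← hcomb, ← hcomb, hwz, hvz, sub_self]
  refine ⟨w, v, ∑ x, w x * u x 0 - ∑ x, v x * u x 0, hw, hv, fun k => ?_⟩
  have := hp.eq_of_sum_smul_eq_zero h0 k 0
  linarith

/-- Otherwise each ray has a threshold `θ` with the points of `x` below it and those of `y` above
it. The functional summing the coordinates divided by the thresholds is then below 1 on the part `x`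
and above 1 on the part `y`. -/
theorem exists_isAbove_of_le {c : Fin 4 → Fin 3 → ℝ} (hc : ∀ i s, 0 < c i s)
    (hanti : ∀ i, StrictAnti (c i)) {f : Fin 4 × Fin 3 → Fin 4} {x y : Fin 4} (hxy : x ≠ y)
    {w v : Fin 4 × Fin 3 → ℝ} (hw : IsPartWeight f x w) (hv : IsPartWeight f y v)
    (hle : ∀ k, ∑ q, v q * (Pi.single q.1 (c q.1 q.2) : Fin 4 → ℝ) k ≤
      ∑ q, w q * (Pi.single q.1 (c q.1 q.2) : Fin 4 → ℝ) k) :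
    ∃ r, IsAbove f r x y := by
  by_contra! hno
  have hθ : ∀ r, ∃ θ, 0 < θ ∧ (∀ s, f (r, s) = x → c r s < θ) ∧ ∀ s, f (r, s) = y → θ < c r s := by
    intro r
    obtain ⟨θ, h1, h2⟩ := Set.Finite.exists_between'
      -- Inserting 0 makes the threshold positive.
      (s := insert 0 (c r '' {s | f (r, s) = x})) (t := c r '' {s | f (r, s) = y})
      (Set.toFinite _) (Set.toFinite _) (by
        rintro _ (rfl | ⟨s, hs, rfl⟩) _ ⟨t, ht, rfl⟩
        · exact hc r t
        · refine hanti r ?_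
          rcases lt_trichotomy s t with h | h | h
          · exact absurd ⟨s, t, h, hs, ht⟩ (hno r)
          · subst h
            exact absurd (hs.symm.trans ht) hxy
          · exact h)
    exact ⟨θ, h1 0 (by simp), fun s hs => h1 _ (Or.inr ⟨s, hs, rfl⟩), fun s hs => h2 _ ⟨s, hs, rfl⟩⟩
  choose θ hθ0 hθx hθy using hθ
  have hsum : ∀ w : Fin 4 × Fin 3 → ℝ,
      ∑ k, (∑ q, w q * (Pi.single q.1 (c q.1 q.2) : Fin 4 → ℝ) k) / θ k =
        ∑ q, w q * (c q.1 q.2 / θ q.1) := by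
    intro w
    simp only [Finset.sum_div]
    rw [Finset.sum_comm]
    refine Finset.sum_congr rfl fun q _ => ?_
    rw [Finset.sum_eq_single q.1 (fun k _ hk => by simp [hk]) (by simp)]
    simp [mul_div_assoc]
  have h1 : ∑ q, w q * (c q.1 q.2 / θ q.1) < 1 := hw.sum_mul_lt fun q hq =>
    (div_lt_one (hθ0 _)).2 (hθx _ _ hq)
  have h2 : 1 < ∑ q, v q * (c q.1 q.2 / θ q.1) := hv.lt_sum_mul fun q hq =>
    (one_lt_div (hθ0 _)).2 (hθy _ _ hq)
  rw [← hsum] at h1 h2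
  have h3 := Finset.sum_le_sum fun k (_ : k ∈ Finset.univ) =>
    div_le_div_of_nonneg_right (hle k) (hθ0 k).le
  linarith

theorem isFull_of_forall_pos {c : Fin 4 → Fin 3 → ℝ} {f : Fin 4 × Fin 3 → Fin 4} {x : Fin 4}
    {w : Fin 4 × Fin 3 → ℝ} (hw : IsPartWeight f x w)
    (hpos : ∀ k, 0 < ∑ q, w q * (Pi.single q.1 (c q.1 q.2) : Fin 4 → ℝ) k) : IsFull f x := by
  intro r
  obtain ⟨q, -, hq⟩ := Finset.exists_ne_zero_of_sum_ne_zero (hpos r).ne'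
  have hqr : q.1 = r := by
    by_contra h
    exact hq (by rw [Pi.single_eq_of_ne (Ne.symm h), mul_zero])
  have hqx : f q = x := by
    by_contra h
    exact hq (by rw [hw.eq_zero q h, zero_mul])
  exact ⟨q.2, by rw [← hqr]; exact hqx⟩

theorem crosses_of_not_disjoint {p : Fin 4 → EuclideanSpace ℝ (Fin 3)} (hp : IsCenteredSimplex p)
    {c : Fin 4 → Fin 3 → ℝ} (hc : ∀ i s, 0 < c i s) (hanti : ∀ i, StrictAnti (c i))
    {f : Fin 4 × Fin 3 → Fin 4} {x y : Fin 4} (hxy : x ≠ y)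
    (h : ¬ Disjoint (partHull (rayConfig p c) f x) (partHull (rayConfig p c) f y)) :
    Crosses f x y := by
  have hcoord : ∀ q, rayConfig p c q = ∑ k, (Pi.single q.1 (c q.1 q.2) : Fin 4 → ℝ) k • p k := by
    intro q
    rw [Finset.sum_eq_single q.1 (fun k _ hk => by simp [hk]) (by simp)]
    simp [rayConfig]
  obtain ⟨w, v, t, hw, hv, ht⟩ := hp.exists_weights hcoord h
  have hnonneg : ∀ {z : Fin 4} {w : Fin 4 × Fin 3 → ℝ}, IsPartWeight f z w →
      ∀ k, 0 ≤ ∑ q, w q * (Pi.single q.1 (c q.1 q.2) : Fin 4 → ℝ) k := by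
    intro z w hw k
    refine Finset.sum_nonneg fun q _ => mul_nonneg (hw.nonneg q) ?_
    have : (0 : Fin 4 → ℝ) ≤ Pi.single q.1 (c q.1 q.2) := Pi.single_nonneg.2 (hc _ _).le
    exact this k
  have above := exists_isAbove_of_le hc hanti hxy hw hv
  have below := exists_isAbove_of_le hc hanti hxy.symm hv hw
  -- The sign of `t` selects the clause of `Crosses`: for `t ≠ 0` one part has strictly larger,
  -- hence positive, coordinates on all rays.
  rcases lt_trichotomy t 0 with h0 | h0 | h0
  · refine Or.inr (Or.inr ⟨isFull_of_forall_pos (c := c) hv fun k => ?_, below fun k => ?_⟩)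
    · linarith [ht k, hnonneg hw k]
    · linarith [ht k]
  · exact Or.inl ⟨above fun k => by linarith [ht k], below fun k => by linarith [ht k]⟩
  · refine Or.inr (Or.inl ⟨isFull_of_forall_pos (c := c) hw fun k => ?_, above fun k => ?_⟩)
    · linarith [ht k, hnonneg hv k]
    · linarith [ht k]

/-- Two parts are disjoint if the functional `coordinate b - coordinate m` separates them weakly, and
in the separating plane the first part is a point on the ray `l`, the second part a segment from the
ray `a` to a different point on the ray `l`. -/
theorem IsCenteredSimplex.disjoint_partHull {d r : ℕ} {p : Fin (d + 1) → EuclideanSpace ℝ (Fin d)}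
    (hp : IsCenteredSimplex p) {ι : Type*} [Fintype ι] {u : ι → Fin (d + 1) → ℝ}
    {q : ι → EuclideanSpace ℝ (Fin d)} (hq : ∀ x, q x = ∑ k, u x k • p k) {f : ι → Fin r}
    {i j : Fin r} {a b l m : Fin (d + 1)} (hab : a ≠ b) (hal : a ≠ l) (ham : a ≠ m) (hbl : b ≠ l)
    (hml : m ≠ l) {s s' : ℝ} (hs : s ≠ s')
    (hi : ∀ x, f x = i → 0 < u x b - u x m ∨ u x = Pi.single l s)
    (hj : ∀ x, f x = j → u x b - u x m < 0 ∨ (∃ ρ, 0 < ρ ∧ u x = Pi.single a ρ) ∨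
      u x = Pi.single l s') : Disjoint (partHull q f i) (partHull q f j) := by
  by_contra hdisj
  obtain ⟨w, v, t, hw, hv, ht⟩ := hp.exists_weights hq hdisj
  have hw0 : ∀ x, 0 ≤ w x * (u x b - u x m) := by
    intro x
    by_cases hx : f x = i
    · refine mul_nonneg (hw.nonneg x) ?_
      rcases hi x hx with h | h
      · exact h.le
      · simp [h, hbl, hml]
    · simp [hw.eq_zero x hx]
  have hv0 : ∀ x, 0 ≤ -(v x * (u x b - u x m)) := by
    intro x
    by_cases hx : f x = j
    · rw [neg_nonneg]
      refine mul_nonpos_of_nonneg_of_nonpos (hv.nonneg x) ?_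
      rcases hj x hx with h | ⟨ρ, -, h⟩ | h
      · exact h.le
      · simp [h, hab.symm, ham.symm]
      · simp [h, hbl, hml]
    · simp [hv.eq_zero x hx]
  -- The constant `t` cancels in a difference of coordinates, so all the weight lies in the
  -- separating plane.
  have hsum : ∑ x, (w x * (u x b - u x m) + -(v x * (u x b - u x m))) = 0 := by
    simp only [mul_sub, Finset.sum_add_distrib, Finset.sum_sub_distrib, Finset.sum_neg_distrib]
    linarith [ht b, ht m]
  have hzero : ∀ x, w x * (u x b - u x m) = 0 ∧ v x * (u x b - u x m) = 0 := by
    intro x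
    have := (Finset.sum_eq_zero_iff_of_nonneg fun x _ => add_nonneg (hw0 x) (hv0 x)).1 hsum x
      (Finset.mem_univ _)
    constructor <;> linarith [hw0 x, hv0 x]
  have hwu : ∀ x k, w x * u x k = w x * (Pi.single l s : Fin (d + 1) → ℝ) k := by
    intro x k
    by_cases hx : w x = 0
    · simp [hx]
    have hfx : f x = i := by
      by_contra h
      exact hx (hw.eq_zero x h)
    rcases hi x hfx with h | h
    · exact absurd (hzero x).1 (mul_ne_zero hx h.ne')
    · rw [h]
  have hvu : ∀ x, v x ≠ 0 → (∃ ρ, 0 < ρ ∧ u x = Pi.single a ρ) ∨ u x = Pi.single l s' := by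
    intro x hx
    have hfx : f x = j := by
      by_contra h
      exact hx (hv.eq_zero x h)
    exact (hj x hfx).resolve_left fun h => mul_ne_zero hx h.ne (hzero x).2
  have hα : ∀ k, ∑ x, w x * u x k = (Pi.single l s : Fin (d + 1) → ℝ) k := by
    intro k
    simp only [hwu, ← Finset.sum_mul, hw.sum_eq_one, one_mul]
  have ht0 : t = 0 := by
    have h := ht m
    rw [hα, Pi.single_eq_of_ne hml, Finset.sum_eq_zero] at h
    · linarith
    · intro x _
      by_cases hx : v x = 0
      · simp [hx]
      rcases hvu x hx with ⟨ρ, -, h⟩ | h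
      · simp [h, ham.symm]
      · simp [h, hml]
  -- With no weight left on the ray `a`, the second part is reduced to its point on the ray `l`,
  -- giving `s = s'`.
  have hva : ∑ x, v x * u x a = 0 := by
    have h := ht a
    rw [hα, Pi.single_eq_of_ne hal] at h
    linarith
  have hva' : ∀ x, v x * u x a = 0 := by
    have := Finset.sum_eq_zero_iff_of_nonneg (s := Finset.univ) (f := fun x => v x * u x a)
      fun x _ => by
        by_cases hx : v x = 0
        · simp [hx]
        refine mul_nonneg (hv.nonneg x) ?_
        rcases hvu x hx with ⟨ρ, hρ, h⟩ | h
        · simp [h, hρ.le]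
        · simp [h, hal]
    exact fun x => this.1 hva x (Finset.mem_univ _)
  have hvl : ∀ x, v x * u x l = v x * s' := by
    intro x
    by_cases hx : v x = 0
    · simp [hx]
    rcases hvu x hx with ⟨ρ, hρ, h⟩ | h
    · exact absurd (hva' x) (mul_ne_zero hx (by simp [h, hρ.ne']))
    · simp [h]
  have h := ht l
  rw [hα, Pi.single_eq_same, ht0, add_zero] at h
  simp only [hvl, ← Finset.sum_mul, hv.sum_eq_one, one_mul] at h
  exact hs h

/-- Strict separation of compact hulls is an open condition on finitely many points. -/
theorem eventually_disjoint_partHull {Z ι : Type*} [TopologicalSpace Z] [Finite ι] {d r : ℕ}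
    {a : Z → ι → EuclideanSpace ℝ (Fin d)} {z₀ : Z} (ha : ∀ x, ContinuousAt (fun z => a z x) z₀)
    {f : ι → Fin r} {i j : Fin r} (h : Disjoint (partHull (a z₀) f i) (partHull (a z₀) f j)) :
    ∀ᶠ z in nhds z₀, Disjoint (partHull (a z) f i) (partHull (a z) f j) := by
  have hcomp : ∀ i, IsCompact (partHull (a z₀) f i) := fun i =>
    (Set.toFinite _).isCompact_convexHull ℝ
  obtain ⟨g, s, t, hs, hst, ht⟩ := geometric_hahn_banach_compact_closed (convex_convexHull ℝ _)
    (hcomp i) (convex_convexHull ℝ _) (hcomp j).isClosed h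
  have hg : ∀ x, ContinuousAt (fun z => g (a z x)) z₀ := fun x =>
    g.continuous.continuousAt.comp (ha x)
  have h1 : ∀ᶠ z in nhds z₀, ∀ x, f x = i → g (a z x) < s := by
    rw [Filter.eventually_all]
    intro x
    by_cases hx : f x = i
    · filter_upwards [(hg x).eventually_lt_const (hs _ (subset_convexHull ℝ _ ⟨x, hx, rfl⟩))]
        with z hz _ using hz
    · exact Filter.Eventually.of_forall fun z h => absurd h hx
  have h2 : ∀ᶠ z in nhds z₀, ∀ x, f x = j → t < g (a z x) := by
    rw [Filter.eventually_all]
    intro x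
    by_cases hx : f x = j
    · filter_upwards [(hg x).eventually_const_lt (ht _ (subset_convexHull ℝ _ ⟨x, hx, rfl⟩))]
        with z hz _ using hz
    · exact Filter.Eventually.of_forall fun z h => absurd h hx
  filter_upwards [h1, h2] with z hz1 hz2
  have hi : partHull (a z) f i ⊆ {y | g y < s} := by
    refine convexHull_min ?_ (convex_halfSpace_lt g.toLinearMap.isLinear s)
    rintro _ ⟨x, hx, rfl⟩
    exact hz1 x hx
  have hj : partHull (a z) f j ⊆ {y | t < g y} := by
    refine convexHull_min ?_ (convex_halfSpace_gt g.toLinearMap.isLinear t)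
    rintro _ ⟨x, hx, rfl⟩
    exact hz2 x hx
  rw [Set.disjoint_left]
  intro y hy hy'
  have h1 : g y < s := hi hy
  have h2 : t < g y := hj hy'
  linarith

/-! ### The perturbed configuration. -/

theorem perturbedRayCoord_of_ne {c : Fin 4 → Fin 3 → ℝ} {δ ε : ℝ} {x : Fin 4 × Fin 3}
    (h : x ≠ (0, 0)) (h' : x ≠ (3, 2)) :
    perturbedRayCoord c δ ε x = Pi.single x.1 (c x.1 x.2) := by
  simp [perturbedRayCoord, h, h']

theorem exists_complement_zero_three : ∀ j : Fin 4, j ≠ 0 → j ≠ 3 →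
    ∃ l, l ≠ 0 ∧ l ≠ 3 ∧ l ≠ j ∧ ∀ r, r = 0 ∨ r = 3 ∨ r = j ∨ r = l := by
  decide

theorem exists_disjoint_of_crosses {p : Fin 4 → EuclideanSpace ℝ (Fin 3)}
    (hp : IsCenteredSimplex p) {c : Fin 4 → Fin 3 → ℝ} (hc : ∀ i s, 0 < c i s)
    (hanti : ∀ i, StrictAnti (c i)) {f : Fin 4 × Fin 3 → Fin 4}
    (H : ∀ x y, x ≠ y → Crosses f x y) {δ ε : ℝ} (hδ : 0 < δ) (hε : 0 < ε) :
    ∃ i j : Fin 4, i ≠ j ∧ Disjoint (partHull (perturbedRayConfig p c δ ε) f i)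
      (partHull (perturbedRayConfig p c δ ε) f j) := by
  obtain ⟨hinj, m, hm, hmiss, hocc, hno⟩ := exists_missing_label H
  have hcoord := perturbedRayConfig_eq_sum p c δ ε
  have hon : ∀ r q, q ≠ r → ∃ s, f (r, s) = m q := fun r q h => hocc r _ (hm.1.ne h)
  obtain ⟨j, hj⟩ := hm.2 (f (0, 0))
  have hj0 : j ≠ 0 := fun h => hmiss 0 0 (by rw [← hj, h])
  by_cases hj3 : j = 3
  · subst hj3
    obtain ⟨k, hk⟩ := hm.2 (f (3, 2))
    have hk3 : k ≠ 3 := fun h => hmiss 3 2 (by rw [← hk, h])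
    have hk0 : k ≠ 0 := fun h => hno 0 3 (by decide) hj.symm (by rw [← hk, h])
    obtain ⟨l, hl0, hl3, hlk, hall⟩ := exists_complement_zero_three k hk0 hk3
    obtain ⟨s, hs⟩ := hon l k hlk.symm
    obtain ⟨t, ht⟩ := hon l 0 hl0.symm
    have hst : s ≠ t := fun h => hk0 (hm.1 (by rw [← hs, ← ht, h]))
    -- The only point of `m k` on the ray 3 is the lowest one, which the `ε`-shift moves off the
    -- plane where coordinates 0 and `k` agree. What remains of `m k` in this plane is its point on
    -- the ray `l`.
    refine ⟨m k, m 0, hm.1.ne hk0, hp.disjoint_partHull hcoord (a := 3) (b := 0) (l := l) (m := k)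
      (by decide) hl3.symm hk3.symm hl0.symm hlk.symm ((hanti l).injective.ne hst) ?_ ?_⟩
    · rintro ⟨r, q⟩ hx
      rcases hall r with rfl | rfl | rfl | rfl
      · left
        have := hc 0 q
        simp only [perturbedRayCoord]
        split_ifs <;> simp_all
      · left
        have hq : q = 2 := hinj 3 _ _ (hx.trans hk)
        subst hq
        have := mul_pos hε (hc 0 2)
        simpa [perturbedRayCoord, hk0, hk3] using this
      · exact absurd hx (hmiss _ _)
      · right
        have hq : q = s := hinj _ _ _ (hx.trans hs.symm)
        subst hq
        exact perturbedRayCoord_of_ne (by simp [hl0]) (by simp [hl3])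
    · rintro ⟨r, q⟩ hx
      rcases hall r with rfl | rfl | rfl | rfl
      · exact absurd hx (hmiss _ _)
      · right; left
        have hq : q ≠ 2 := fun h => hk0 (hm.1 (by rw [hk, ← hx, h]))
        exact ⟨c 3 q, hc 3 q, perturbedRayCoord_of_ne (by simp) (by simp [hq])⟩
      · left
        rw [perturbedRayCoord_of_ne (by simp [hk0]) (by simp [hk3])]
        simp [hk0.symm, hc]
      · right; right
        have hq : q = t := hinj _ _ _ (hx.trans ht.symm)
        subst hq
        exact perturbedRayCoord_of_ne (by simp [hl0]) (by simp [hl3])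
  · obtain ⟨l, hl0, hl3, hlj, hall⟩ := exists_complement_zero_three j hj0 hj3
    obtain ⟨s, hs⟩ := hon l j hlj.symm
    obtain ⟨t, ht⟩ := hon l 3 hl3.symm
    have hst : s ≠ t := fun h => hj3 (hm.1 (by rw [← hs, ← ht, h]))
    -- Here the `δ`-shift moves the only point of `m j` on the ray 0 off the plane where coordinates
    -- 3 and `j` agree.
    refine ⟨m j, m 3, hm.1.ne hj3, hp.disjoint_partHull hcoord (a := 0) (b := 3) (l := l) (m := j)
      (by decide) hl0.symm hj0.symm hl3.symm hlj.symm ((hanti l).injective.ne hst) ?_ ?_⟩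
    · rintro ⟨r, q⟩ hx
      rcases hall r with rfl | rfl | rfl | rfl
      · left
        have hq : q = 0 := hinj 0 _ _ (hx.trans hj)
        subst hq
        have := mul_pos hδ (hc 3 0)
        simpa [perturbedRayCoord, hj0, hj3] using this
      · left
        have := hc 3 q
        simp only [perturbedRayCoord]
        split_ifs <;> simp_all
      · exact absurd hx (hmiss _ _)
      · right
        have hq : q = s := hinj _ _ _ (hx.trans hs.symm)
        subst hq
        exact perturbedRayCoord_of_ne (by simp [hl0]) (by simp [hl3])
    · rintro ⟨r, q⟩ hx
      rcases hall r with rfl | rfl | rfl | rfl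
      · right; left
        have hq : q ≠ 0 := fun h => hj3 (hm.1 (by rw [hj, ← hx, h]))
        exact ⟨c 0 q, hc 0 q, perturbedRayCoord_of_ne (by simp [hq]) (by simp)⟩
      · exact absurd hx (hmiss _ _)
      · left
        rw [perturbedRayCoord_of_ne (by simp [hj0]) (by simp [hj3])]
        simp [Ne.symm hj3, hc]
      · right; right
        have hq : q = t := hinj _ _ _ (hx.trans ht.symm)
        subst hq
        exact perturbedRayCoord_of_ne (by simp [hl0]) (by simp [hl3])

theorem perturbedRayConfig_zero (p : Fin 4 → EuclideanSpace ℝ (Fin 3)) (c : Fin 4 → Fin 3 → ℝ) :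
    perturbedRayConfig p c 0 0 = rayConfig p c := by
  ext1 x
  unfold perturbedRayConfig
  split_ifs with h h <;> simp [h]

theorem continuous_perturbedRayConfig (p : Fin 4 → EuclideanSpace ℝ (Fin 3))
    (c : Fin 4 → Fin 3 → ℝ) (x : Fin 4 × Fin 3) :
    Continuous fun z : ℝ × ℝ => perturbedRayConfig p c z.1 z.2 x := by
  unfold perturbedRayConfig
  split_ifs <;> fun_prop

theorem rayConfig_injective {p : Fin 4 → EuclideanSpace ℝ (Fin 3)} (hp : IsCenteredSimplex p)
    {c : Fin 4 → Fin 3 → ℝ} (hc : ∀ i s, 0 < c i s) (hanti : ∀ i, StrictAnti (c i)) :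
    Function.Injective (rayConfig p c) := by
  rintro ⟨i, s⟩ ⟨j, t⟩ h
  have h0 : ∑ k, ((Pi.single i (c i s) : Fin 4 → ℝ) k - (Pi.single j (c j t) : Fin 4 → ℝ) k) • p k
      = 0 := by
    simp only [sub_smul, Finset.sum_sub_distrib]
    rw [Finset.sum_eq_single i (fun k _ hk => by simp [hk]) (by simp),
      Finset.sum_eq_single j (fun k _ hk => by simp [hk]) (by simp)]
    simpa [rayConfig, sub_eq_zero] using h
  have hij : i = j := by
    by_contra hij
    have := hp.eq_of_sum_smul_eq_zero h0 i j
    simp only [Pi.single_eq_same, Pi.single_eq_of_ne hij, Pi.single_eq_of_ne (Ne.symm hij)] at this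
    linarith [hc i s, hc j t]
  subst hij
  obtain ⟨k, hk⟩ : ∃ k, k ≠ i := exists_ne i
  have := hp.eq_of_sum_smul_eq_zero h0 i k
  simp only [Pi.single_eq_same, Pi.single_eq_of_ne hk, sub_self, sub_eq_zero] at this
  rw [(hanti i).injective this]

theorem exists_perturbation_bound {p : Fin 4 → EuclideanSpace ℝ (Fin 3)} (hp : IsCenteredSimplex p)
    {c : Fin 4 → Fin 3 → ℝ} (hc : ∀ i s, 0 < c i s) (hanti : ∀ i, StrictAnti (c i)) :
    ∃ δ₀ : ℝ, 0 < δ₀ ∧ ∀ δ ε : ℝ, 0 < δ → δ < δ₀ → 0 < ε → ε < δ₀ →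
      Function.Injective (perturbedRayConfig p c δ ε) ∧
      ∀ f : Fin 4 × Fin 3 → Fin 4, ∃ i j : Fin 4, i ≠ j ∧
        Disjoint (partHull (perturbedRayConfig p c δ ε) f i)
          (partHull (perturbedRayConfig p c δ ε) f j) := by
  have hcont := continuous_perturbedRayConfig p c
  have hinj : ∀ᶠ z : ℝ × ℝ in nhds (0, 0), ∀ x y, x ≠ y →
      perturbedRayConfig p c z.1 z.2 x ≠ perturbedRayConfig p c z.1 z.2 y := by
    simp only [Filter.eventually_all]
    intro x y hxy
    refine ((hcont x).sub (hcont y)).continuousAt.eventually_ne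
      (sub_ne_zero.2 ?_) |>.mono fun z hz => sub_ne_zero.1 hz
    change perturbedRayConfig p c 0 0 x ≠ perturbedRayConfig p c 0 0 y
    rw [perturbedRayConfig_zero]
    exact (rayConfig_injective hp hc hanti).ne hxy
  have hdisj : ∀ᶠ z : ℝ × ℝ in nhds (0, 0), ∀ f : Fin 4 × Fin 3 → Fin 4,
      (¬ ∀ x y, x ≠ y → Crosses f x y) → ∃ i j : Fin 4, i ≠ j ∧
        Disjoint (partHull (perturbedRayConfig p c z.1 z.2) f i)
          (partHull (perturbedRayConfig p c z.1 z.2) f j) := by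
    rw [Filter.eventually_all]
    intro f
    by_cases hf : ∀ x y, x ≠ y → Crosses f x y
    · exact Filter.Eventually.of_forall fun z h => absurd hf h
    push Not at hf
    obtain ⟨x, y, hxy, hnot⟩ := hf
    have h0 : Disjoint (partHull (rayConfig p c) f x) (partHull (rayConfig p c) f y) := by
      by_contra h
      exact hnot (crosses_of_not_disjoint hp hc hanti hxy h)
    rw [← perturbedRayConfig_zero] at h0
    have hev := eventually_disjoint_partHull (Z := ℝ × ℝ) (z₀ := (0, 0))
      (a := fun z => perturbedRayConfig p c z.1 z.2) (fun x => (hcont x).continuousAt) h0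
    exact hev.mono fun z hz _ => ⟨x, y, hxy, hz⟩
  obtain ⟨δ₀, hδ₀, hball⟩ := Metric.eventually_nhds_iff.1 (hinj.and hdisj)
  refine ⟨δ₀, hδ₀, fun δ ε hδ hδ' hε hε' => ?_⟩
  obtain ⟨h1, h2⟩ := @hball (δ, ε) (by
    rw [Prod.dist_eq, max_lt_iff, Real.dist_eq, Real.dist_eq, sub_zero, sub_zero, abs_of_pos hδ,
      abs_of_pos hε]
    exact ⟨hδ', hε'⟩)
  refine ⟨fun x y hxy => ?_, fun f => ?_⟩
  · by_contra hne
    exact h1 x y hne hxy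
  · by_cases H : ∀ x y, x ≠ y → Crosses f x y
    · exact exists_disjoint_of_crosses hp hc hanti H hδ hε
    · exact h2 f H

/-! ### The value of the Reay number. -/

theorem exists_isCenteredSimplex (d : ℕ) :
    ∃ p : Fin (d + 1) → EuclideanSpace ℝ (Fin d), IsCenteredSimplex p := by
  let e : Fin d → EuclideanSpace ℝ (Fin d) := fun k => EuclideanSpace.single k 1
  refine ⟨Fin.cons (-∑ k, e k) e, ?_, fun i => ?_⟩
  · simp [Fin.sum_univ_succ]
  · rw [Fintype.linearIndependent_iff]
    intro g hg
    set α : Fin (d + 1) → ℝ := fun k => if h : k ≠ i then g ⟨k, h⟩ else 0 with hα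
    have hsum : ∑ k, α k • (Fin.cons (-∑ k, e k) e : Fin (d + 1) → EuclideanSpace ℝ (Fin d)) k
        = 0 := by
      rw [Fintype.sum_eq_add_sum_subtype_ne _ i, ← hg]
      simp only [hα, ne_eq, not_true_eq_false, dite_false, zero_smul, zero_add]
      exact Finset.sum_congr rfl fun k _ => by rw [dif_pos k.2]
    -- Each coordinate of the relation equates a coefficient with that of the vector `-∑ k, e k`;
    -- the coefficient at the omitted index `i` is zero, so all vanish.
    have hconst : ∀ k : Fin d, α k.succ = α 0 := by
      intro k
      have := congrArg (fun y : EuclideanSpace ℝ (Fin d) => y k) hsum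
      simp [Fin.sum_univ_succ, e, Pi.single_apply] at this
      linarith
    have hconst' : ∀ k, α k = α 0 := Fin.cases rfl hconst
    have hi : α i = 0 := by simp [hα]
    rintro ⟨k, hk⟩
    have : α k = 0 := by rw [hconst', ← hconst' i, hi]
    simpa [hα, hk] using this

theorem HasReayProperty.of_le_tverberg {d r k n : ℕ} (hr : 0 < r)
    (hn : tverbergNumber d r ≤ n) : HasReayProperty d r k n := by
  intro a
  obtain ⟨s, rfl⟩ := Nat.exists_eq_add_of_le' hr
  obtain ⟨f, z, hz⟩ := exists_tverberg_partition (s := s) (by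
    rw [Fintype.card_fin]
    exact hn) a
  exact ⟨f, fun S _ => ⟨z, Set.mem_iInter₂.2 fun j _ => Set.mem_iInter.1 hz j⟩⟩

/-- Extra points join the part 0 and only enlarge hulls; thus failure for 12 points excludes every
smaller number. -/
theorem HasReayProperty.mono {d r k m n : ℕ} (hmn : m ≤ n) (h : HasReayProperty d r k m)
    (hr : 0 < r) : HasReayProperty d r k n := by
  intro a
  obtain ⟨f, hf⟩ := h (a ∘ Fin.castLE hmn)
  refine ⟨fun x => if hx : x.1 < m then f ⟨x.1, hx⟩ else ⟨0, hr⟩, fun S hS => ?_⟩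
  refine (hf S hS).mono (Set.iInter₂_mono fun j _ => convexHull_mono ?_)
  rintro _ ⟨x, hx, rfl⟩
  refine ⟨Fin.castLE hmn x, ?_, rfl⟩
  simpa using hx

theorem not_hasReayProperty_twelve : ¬ HasReayProperty 3 4 2 12 := by
  intro h
  obtain ⟨p, hp⟩ := exists_isCenteredSimplex 3
  let c : Fin 4 → Fin 3 → ℝ := fun _ s => 3 - (s.1 : ℝ)
  have hc : ∀ i s, 0 < c i s := by
    intro i s
    simp [c]
  have hanti : ∀ i, StrictAnti (c i) := by
    intro i s t hst
    have : (s.1 : ℝ) < t.1 := by exact_mod_cast hst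
    simpa [c] using this
  obtain ⟨δ₀, hδ₀, hδ⟩ := exists_perturbation_bound hp hc hanti
  obtain ⟨-, hpart⟩ := hδ (δ₀ / 2) (δ₀ / 2) (by linarith) (by linarith) (by linarith) (by linarith)
  set q := perturbedRayConfig p c (δ₀ / 2) (δ₀ / 2)
  let e : Fin 12 ≃ Fin 4 × Fin 3 := (finProdFinEquiv (m := 4) (n := 3)).symm
  obtain ⟨f, hf⟩ := h (q ∘ e)
  obtain ⟨i, j, hij, hdisj⟩ := hpart (f ∘ e.symm)
  have hhull : ∀ i, partHull (q ∘ e) f i ⊆ partHull q (f ∘ e.symm) i := by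
    intro i
    refine convexHull_mono ?_
    rintro _ ⟨x, hx, rfl⟩
    exact ⟨e x, by simpa using hx, rfl⟩
  obtain ⟨z, hz⟩ := hf {i, j} (Finset.card_pair hij)
  rw [Set.mem_iInter₂] at hz
  exact Set.disjoint_left.1 hdisj (hhull i (hz i (by simp))) (hhull j (hz j (by simp)))

theorem theorem3 :
    (reayNumber 3 4 2 = tverbergNumber 3 4 ∧ tverbergNumber 3 4 = 13) ∧
    ∀ p : Fin 4 → EuclideanSpace ℝ (Fin 3), IsCenteredSimplex p →
      ∀ c : Fin 4 → Fin 3 → ℝ, (∀ i s, 0 < c i s) → (∀ i, StrictAnti (c i)) →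
        ∃ δ₀ : ℝ, 0 < δ₀ ∧ ∀ δ ε : ℝ, 0 < δ → δ < δ₀ → 0 < ε → ε < δ₀ →
          Function.Injective (perturbedRayConfig p c δ ε) ∧
          ∀ f : Fin 4 × Fin 3 → Fin 4, ∃ i j : Fin 4, i ≠ j ∧
            Disjoint (partHull (perturbedRayConfig p c δ ε) f i)
              (partHull (perturbedRayConfig p c δ ε) f j) := by
  refine ⟨⟨le_antisymm (Nat.sInf_le ⟨by decide, .of_le_tverberg (by decide) le_rfl⟩) ?_, rfl⟩,
    fun p hp c hc hanti => exists_perturbation_bound hp hc hanti⟩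
  refine le_csInf ⟨_, by decide, .of_le_tverberg (by decide) le_rfl⟩ ?_
  rintro n ⟨-, hn⟩
  by_contra hlt
  exact not_hasReayProperty_twelve (hn.mono (Nat.le_of_lt_succ (not_le.1 hlt)) (by decide))
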